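/- Let $n$ be a positive integer, $N=\{1,\dots,n\}$, and let $\chi_i\in\mathbb R^n$ be the $i$-th unit vector. A function $f:\mathbb R^n\to\mathbb R\cup\{+\infty\}$ with $\operatorname{dom} f=\{x\mid f(x)<+\infty\}$ is called polyhedral M-convex if its epigraph $\{(x,\alpha)\in\mathbb R^n\times\mathbb R\mid f(x)\le\alpha\}$ is a polyhedron and, for all $x,y\in\operatorname{dom} f$ and $i\in N$ with $x(i)>y(i)$, there exist $j\in N$ with $x(j)<y(j)$ and $\epsilon_0>0$ such that \[ f(x)+f(y)\ \ge\ f(x-\epsilon(\chi_i-\chi_j))+f(y+\epsilon(\chi_i-\chi_j))\qquad(0\le\epsilon\le\epsilon_0). \] For such $f$, $x\in\operatorname{dom} f$ and $i,j\in N$ put \[ f'_{\mathbb R}(x;i,j)=\lim_{\alpha\downarrow0}\frac{f(x+\alpha(\chi_i-\chi_j))-f(x)}{\alpha}\in\mathbb R\cup\{+\infty\},\qquad \phi_{\mathbb R}(x)=\min_{i,j\in N}f'_{\mathbb R}(x;i,j), \] \[ \bar c_{\mathbb R}(x;i,j)=\max\{\lambda\ge0\mid f(x+\lambda(\chi_i-\chi_j))-f(x)=\lambda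 f'_{\mathbb R}(x;i,j)\}. \] The procedure PM-IncSlope$(x)$ sets $y:=x$ and $N^+:=N$, and then, as long as $N^+\neq\emptyset$, does the following. It takes any $i\in N^+$ and sets $N^-_i:=N\setminus\{i\}$. As long as $N^-_i\ne\emptyset$, it takes any $j\in N^-_i$; if $f'_{\mathbb R}(y;i,j)=\phi_{\mathbb R}(x)$, it sets $y:=y+\bar c_{\mathbb R}(y;i,j)(\chi_i-\chi_j)$; then it sets $N^-_i:=N^-_i\setminus\{j\}$. When $N^-_i=\emptyset$, it sets $N^+:=N^+\setminus\{i\}$. When $N^+=\emptyset$, it outputs $y$. **Theorem.** Let $f$ be polyhedral M-convex, and let $x\in\operatorname{dom} f$ satisfy $\phi_{\mathbb R}(x)<0$. Then every output $x'$ of PM-IncSlope$(x)$, whatever elements $i$ and $j$ are taken, satisfies $\phi_{\mathbb R}(x')>\phi_{\mathbb R}(x)$. If moreover $\operatorname{dom} f$ is bounded, then the procedure never gets stuck on an undefined step length: every partial run of PM-IncSlope$(x)$ can be continued until it produces an output. -/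

import Mathlib

open Filter Topology

noncomputable section

namespace PolyM

variable {n : ℕ}

/-- The effective domain `{x | f x < +∞}` of an extended-real-valued function. -/
def dom (f : (Fin n → ℝ) → EReal) : Set (Fin n → ℝ) := {x | f x < ⊤}

/-- The direction `χ_i - χ_j`, a difference of two unit vectors (zero if `i = j`). -/
def dir (i j : Fin n) : Fin n → ℝ := Pi.single i 1 - Pi.single j 1

/-- A polyhedral convex function `ℝⁿ → ℝ ∪ {+∞}`: the value `-∞` is not taken, and the epigraph
`{(x, α) ∈ ℝⁿ × ℝ | f x ≤ α}` is the intersection of finitely many closed half-spaces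
`{(x, α) | p x + q α ≤ b}` of `ℝⁿ × ℝ`. -/
def IsPolyhedralConvex (f : (Fin n → ℝ) → EReal) : Prop :=
  (∀ x, f x ≠ ⊥) ∧
    ∃ (m : ℕ) (p : Fin m → Fin n → ℝ) (q b : Fin m → ℝ),
      ∀ (x : Fin n → ℝ) (α : ℝ),
        f x ≤ (α : EReal) ↔ ∀ k, (∑ l, p k l * x l) + q k * α ≤ b k

/-- The exchange axiom over the reals. -/
def ExchangeAxiom (f : (Fin n → ℝ) → EReal) : Prop :=
  ∀ x ∈ dom f, ∀ y ∈ dom f, ∀ i, y i < x i →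
    ∃ j, x j < y j ∧ ∃ ε₀ : ℝ, 0 < ε₀ ∧ ∀ ε ∈ Set.Icc 0 ε₀,
      f (x - ε • dir i j) + f (y + ε • dir i j) ≤ f x + f y

/-- Polyhedral M-convex functions. -/
def IsPolyhedralMConvex (f : (Fin n → ℝ) → EReal) : Prop :=
  IsPolyhedralConvex f ∧ ExchangeAxiom f

/-- The directional derivative `lim_{α ↓ 0} (f (x + α (χ_i - χ_j)) - f x) / α`, a limit in the
extended reals; it exists by `tendsto_dirDeriv` below. -/
def dirDeriv (f : (Fin n → ℝ) → EReal) (x : Fin n → ℝ) (i j : Fin n) : EReal :=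
  limUnder (𝓝[>] (0 : ℝ)) (fun α : ℝ => (f (x + α • dir i j) - f x) / (α : EReal))

/-- For a polyhedral convex function, the limit that defines the directional derivative at a
point of the domain exists. -/
theorem tendsto_dirDeriv {f : (Fin n → ℝ) → EReal} (hf : IsPolyhedralConvex f)
    {x : Fin n → ℝ} (hx : x ∈ dom f) (i j : Fin n) :
    Tendsto (fun α : ℝ => (f (x + α • dir i j) - f x) / (α : EReal)) (𝓝[>] (0 : ℝ))
      (𝓝 (dirDeriv f x i j)) := by
  obtain ⟨hbot, m, p, q, b, hepi⟩ := hf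
  obtain ⟨a, ha⟩ : ∃ a : ℝ, f x = a :=
    ⟨(f x).toReal, (EReal.coe_toReal (ne_of_lt hx) (hbot x)).symm⟩
  have hmono : MonotoneOn (fun α : ℝ => (f (x + α • dir i j) - f x) / (α : EReal))
      (Set.Ioi 0) := by
    intro α hα β hβ hαβ
    have hα0 : (0 : ℝ) < α := hα
    have hβ0 : (0 : ℝ) < β := hβ
    by_cases htop : f (x + β • dir i j) = ⊤
    · have h : (f (x + β • dir i j) - f x) / (β : EReal) = ⊤ := by
        rw [htop, ha, EReal.top_sub_coe]
        exact EReal.top_div_of_pos_ne_top (by exact_mod_cast hβ0) (EReal.coe_ne_top _)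
      simp only [h, le_top]
    · obtain ⟨c, hc⟩ : ∃ c : ℝ, f (x + β • dir i j) = c :=
        ⟨_, (EReal.coe_toReal htop (hbot _)).symm⟩
      have key : f (x + α • dir i j) ≤ ((a + α / β * (c - a) : ℝ) : EReal) := by
        rw [hepi]
        intro k
        have h1 := (hepi x a).1 ha.le k
        have h2 := (hepi (x + β • dir i j) c).1 hc.le k
        have ht1 : α / β ≤ 1 := (div_le_one hβ0).2 hαβ
        have ht0 : 0 ≤ α / β := by positivity
        simp only [Pi.add_apply, Pi.smul_apply, smul_eq_mul, mul_add,
          Finset.sum_add_distrib, mul_left_comm _ α, mul_left_comm _ β,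
          ← Finset.mul_sum] at h2 ⊢
        have e : α = α / β * β := by field_simp
        generalize α / β = t at *
        subst e
        nlinarith [mul_le_mul_of_nonneg_left h2 ht0,
          mul_le_mul_of_nonneg_left h1 (sub_nonneg.2 ht1)]
      obtain ⟨d, hd⟩ : ∃ d : ℝ, f (x + α • dir i j) = d :=
        ⟨_, (EReal.coe_toReal (ne_of_lt (key.trans_lt (EReal.coe_lt_top _))) (hbot _)).symm⟩
      rw [hd, EReal.coe_le_coe_iff] at key
      simp only [hd, hc, ha]
      rw [← EReal.coe_sub, ← EReal.coe_sub, ← EReal.coe_div, ← EReal.coe_div,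
        EReal.coe_le_coe_iff, div_le_div_iff₀ hα0 hβ0]
      have := mul_le_mul_of_nonneg_right key hβ0.le
      have e : (a + α / β * (c - a)) * β = a * β + α * (c - a) := by field_simp
      nlinarith
  exact tendsto_nhds_limUnder ⟨_, hmono.tendsto_nhdsGT (OrderBot.bddBelow _)⟩

/-- The slope of a steepest descent direction: the minimum of the directional derivatives at `x`
over all directions `χ_i - χ_j`. -/
def slope (f : (Fin n → ℝ) → EReal) (x : Fin n → ℝ) : EReal :=
  ⨅ i : Fin n, ⨅ j : Fin n, dirDeriv f x i j

/-- `c` is the step length at `y` in the direction `χ_i - χ_j`: the largest `t ≥ 0` up to which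
`f` has the slope `f'(y; i, j)` along this direction. -/
def IsStepLength (f : (Fin n → ℝ) → EReal) (y : Fin n → ℝ) (i j : Fin n) (c : ℝ) : Prop :=
  IsGreatest {t : ℝ | 0 ≤ t ∧ f (y + t • dir i j) - f y = (t : EReal) * dirDeriv f y i j} c

/-- The states of the procedure. `outer y P`: an element `i` of `P` is to be taken next.
`inner y P i M`: the element `i` of `P` is being processed, and an element `j` of `M` is to be
taken next. -/
inductive State (n : ℕ) : Type
  | outer (y : Fin n → ℝ) (P : Finset (Fin n)) : State n
  | inner (y : Fin n → ℝ) (P : Finset (Fin n)) (i : Fin n) (M : Finset (Fin n)) : State n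

/-- One step of the procedure started at `x`. The elements `i` and `j` are arbitrary choices. -/
inductive Step (f : (Fin n → ℝ) → EReal) (x : Fin n → ℝ) : State n → State n → Prop
  /-- Take any `i ∈ P` and start the inner loop with `M = N \ {i}`. -/
  | choose (y : Fin n → ℝ) (P : Finset (Fin n)) (i : Fin n) (hi : i ∈ P) :
      Step f x (.outer y P) (.inner y P i (Finset.univ.erase i))
  /-- Take any `j ∈ M`; if `f'(y; i, j)` is the slope at `x`, make a long step, and drop `j`. -/
  | move (y : Fin n → ℝ) (P : Finset (Fin n)) (i : Fin n) (M : Finset (Fin n)) (j : Fin n)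
      (hj : j ∈ M) (h : dirDeriv f y i j = slope f x) (c : ℝ) (hc : IsStepLength f y i j c) :
      Step f x (.inner y P i M) (.inner (y + c • dir i j) P i (M.erase j))
  /-- Take any `j ∈ M`; if `f'(y; i, j)` is not the slope at `x`, just drop `j`. -/
  | skip (y : Fin n → ℝ) (P : Finset (Fin n)) (i : Fin n) (M : Finset (Fin n)) (j : Fin n)
      (hj : j ∈ M) (h : dirDeriv f y i j ≠ slope f x) :
      Step f x (.inner y P i M) (.inner y P i (M.erase j))
  /-- Once `M` is empty, drop `i` from `P` and return to the outer loop. -/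
  | next (y : Fin n → ℝ) (P : Finset (Fin n)) (i : Fin n) :
      Step f x (.inner y P i ∅) (.outer y (P.erase i))

/-- The state `t` can be reached from the state `s` by finitely many steps of the procedure
started at `x`. -/
def Reaches (f : (Fin n → ℝ) → EReal) (x : Fin n → ℝ) (s t : State n) : Prop :=
  Relation.ReflTransGen (Step f x) s t

/-- The initial state of the procedure started at `x`. -/
def start (x : Fin n → ℝ) : State n := .outer x Finset.univ

/-- The final state with output `x'`: no element is left for the outer loop. -/
def final (x' : Fin n → ℝ) : State n := .outer x' ∅

/-- `x'` is an output of the procedure started at `x`, for some choices of elements. -/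
def IsOutput (f : (Fin n → ℝ) → EReal) (x x' : Fin n → ℝ) : Prop :=
  Reaches f x (start x) (final x')

end PolyM

end

/-!
The argument rests on one global inequality. If every directional derivative of `f` at `y` is at
least `s`, then `f z ≥ f y + (s / 2) ‖z - y‖₁` for all `z`
(`IsPolyhedralMConvex.add_l1_le`): a violating point closest to `y` could be brought closer to `y`
by the exchange axiom. If equality holds at `z`, the same exchange shows that each coordinate in
which `z` exceeds `y` is the first index of a direction at `y` of slope `s`, and each coordinate in
which `z` is smaller is the second index of such a direction (`exists_dirDeriv_le_of_lt`,
`exists_dirDeriv_le_of_gt`).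

Let `s < 0` be the slope at the start of the procedure, and let `y' = y + c (χ_i - χ_j)` be the end
of a long step. Since `f y' = f y + s c`, equality holds at `y'`, and the global inequality shows
that the slope at `y'` is again at least `s`. A direction `χ_h - χ_k` of slope exactly `s` at `y'`
yields, by local linearity (`IsPolyhedralConvex.eventually_eq`), equality at a point
`z = y' + α (χ_h - χ_k)`, and the coordinates in which `z` differs from `y` reveal the directions
that already had slope `s` at `y`. Hence a direction with first index `i` that has been examined
keeps slope greater than `s`, and so do all directions whose first index has been processed; the
direction `χ_i - χ_j` itself has slope greater than `s` at `y'` because the step length is maximal.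
This is `Invariant`, and at the end of the procedure it covers all directions.

When the domain is bounded, the step length in a direction of slope `s` is the maximum of a
nonempty compact set (`exists_isStepLength`), so every run can be continued; it ends because each
step removes an element from a finite set.
-/

namespace PolyM

variable {n : ℕ}

theorem dir_self (i : Fin n) : dir i i = 0 := by simp [dir]

theorem dir_apply (i j l : Fin n) :
    dir i j l = (if l = i then (1 : ℝ) else 0) - (if l = j then 1 else 0) := by
  simp [dir, Pi.single_apply]

theorem neg_dir (i j : Fin n) : -dir i j = dir j i := by simp [dir]

/-! ### The `ℓ¹`-norm along exchange directions -/

/-- The `ℓ¹`-norm on `ℝⁿ`, whose underlying type carries the supremum norm as its instance. -/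
def l1 (w : Fin n → ℝ) : ℝ := ∑ l, |w l|

theorem continuous_l1 : Continuous (l1 (n := n)) := by
  unfold l1; fun_prop

theorem abs_le_l1 (w : Fin n → ℝ) (l : Fin n) : |w l| ≤ l1 w :=
  Finset.single_le_sum (f := fun l => |w l|) (fun _ _ => abs_nonneg _) (Finset.mem_univ l)

theorem l1_add_le (v w : Fin n → ℝ) : l1 (v + w) ≤ l1 v + l1 w := by
  unfold l1
  rw [← Finset.sum_add_distrib]
  exact Finset.sum_le_sum fun l _ => abs_add_le _ _

theorem l1_smul_dir_le {t : ℝ} (ht : 0 ≤ t) (i j : Fin n) : l1 (t • dir i j) ≤ 2 * t := by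
  have h : ∀ l, |(t • dir i j) l| ≤ (if l = i then t else 0) + (if l = j then t else 0) := by
    intro l
    simp only [Pi.smul_apply, smul_eq_mul, dir_apply]
    split_ifs <;> simp [abs_of_nonneg ht, ht]
  refine (Finset.sum_le_sum fun l _ => h l).trans ?_
  rw [Finset.sum_add_distrib]
  simp only [Finset.sum_ite_eq', Finset.mem_univ, if_true]
  linarith

theorem l1_sub_smul_dir {w : Fin n → ℝ} {h k : Fin n} {ε : ℝ} (hε : 0 < ε) (hh : ε ≤ w h)
    (hk : w k ≤ -ε) : l1 (w - ε • dir h k) = l1 w - 2 * ε := by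
  have hne : h ≠ k := by rintro rfl; linarith
  have e : ∀ l, |(w - ε • dir h k) l|
      = |w l| - ((if l = h then ε else 0) + (if l = k then ε else 0)) := by
    intro l
    simp only [Pi.sub_apply, Pi.smul_apply, smul_eq_mul, dir_apply]
    split_ifs with h1 h2 h2
    · exact absurd (h1.symm.trans h2) hne
    · subst h1
      rw [abs_of_nonneg (by linarith), abs_of_nonneg (by linarith)]; ring
    · subst h2
      rw [abs_of_nonpos (by linarith), abs_of_nonpos (by linarith)]; ring
    · simp
  simp only [l1, e]
  rw [Finset.sum_sub_distrib, Finset.sum_add_distrib]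
  simp only [Finset.sum_ite_eq', Finset.mem_univ, if_true]
  ring

/-! ### Polyhedral convex functions along a direction -/

variable {f : (Fin n → ℝ) → EReal} {x y z : Fin n → ℝ} {a s : ℝ} {i j : Fin n}

theorem mem_dom_of_eq_coe (h : f y = a) : y ∈ dom f := by
  simp [dom, h]

theorem IsPolyhedralConvex.exists_eq_coe (hf : IsPolyhedralConvex f) (hy : y ∈ dom f) :
    ∃ a : ℝ, f y = a :=
  ⟨(f y).toReal, (EReal.coe_toReal (ne_of_lt hy) (hf.1 y)).symm⟩

theorem IsPolyhedralConvex.le_lineMap (hf : IsPolyhedralConvex f) (d : Fin n → ℝ) {b α t : ℝ}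
    (ha : f y ≤ a) (hb : f (y + α • d) ≤ b) (ht0 : 0 ≤ t) (ht1 : t ≤ 1) :
    f (y + (t * α) • d) ≤ ((a + t * (b - a) : ℝ) : EReal) := by
  obtain ⟨-, m, p, q, c, hepi⟩ := hf
  rw [hepi] at ha hb ⊢
  intro k
  have h1 := ha k
  have h2 := hb k
  simp only [Pi.add_apply, Pi.smul_apply, smul_eq_mul, mul_add, Finset.sum_add_distrib,
    mul_left_comm _ α, mul_left_comm _ (t * α), ← Finset.mul_sum] at h2 ⊢
  nlinarith [mul_le_mul_of_nonneg_left h2 ht0, mul_le_mul_of_nonneg_left h1 (sub_nonneg.2 ht1)]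

/-- Sublevel sets of a polyhedral convex function against a continuous bound are closed, because
the epigraph is. -/
theorem IsPolyhedralConvex.isClosed_setOf_le (hf : IsPolyhedralConvex f) {X : Type*}
    [TopologicalSpace X] {u : X → Fin n → ℝ} {g : X → ℝ} (hu : Continuous u)
    (hg : Continuous g) : IsClosed {t | f (u t) ≤ (g t : EReal)} := by
  obtain ⟨-, m, p, q, c, hepi⟩ := hf
  simp only [hepi, Set.ofPred_forall]
  refine isClosed_iInter fun k => isClosed_le ?_ continuous_const
  fun_prop

theorem sub_div_coe_le_iff (ha : f y = a) {α v : ℝ} (hα : 0 < α) (w : Fin n → ℝ) :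
    (f w - f y) / (α : EReal) ≤ (v : EReal) ↔ f w ≤ ((a + v * α : ℝ) : EReal) := by
  rw [EReal.div_le_iff_le_mul (by exact_mod_cast hα) (EReal.coe_ne_top _), ha,
    EReal.sub_le_iff_le_add (by simp) (by simp), ← EReal.coe_mul, ← EReal.coe_add, add_comm a,
    mul_comm]

theorem le_sub_div_coe_iff (ha : f y = a) {α v : ℝ} (hα : 0 < α) (w : Fin n → ℝ) :
    (v : EReal) ≤ (f w - f y) / (α : EReal) ↔ ((a + v * α : ℝ) : EReal) ≤ f w := by
  rw [EReal.le_div_iff_mul_le (by exact_mod_cast hα) (EReal.coe_ne_top _), ha,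
    EReal.le_sub_iff_add_le (by simp) (by simp), ← EReal.coe_mul, ← EReal.coe_add, add_comm a]

/-- By convexity, a lower bound for the directional derivative bounds the function along the
whole ray, not only near its origin. -/
theorem IsPolyhedralConvex.le_of_le_dirDeriv (hf : IsPolyhedralConvex f) (ha : f y = a)
    (hs : (s : EReal) ≤ dirDeriv f y i j) {α : ℝ} (hα : 0 ≤ α) :
    ((a + s * α : ℝ) : EReal) ≤ f (y + α • dir i j) := by
  rcases hα.eq_or_lt with rfl | hα
  · simp [ha]
  by_contra! hlt
  obtain ⟨v, hv1, hv2⟩ := EReal.lt_iff_exists_real_btwn.1 hlt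
  have hv2 : v < a + s * α := by exact_mod_cast hv2
  have hle : dirDeriv f y i j ≤ (((v - a) / α : ℝ) : EReal) := by
    refine le_of_tendsto (tendsto_dirDeriv hf (mem_dom_of_eq_coe ha) i j) ?_
    filter_upwards [Ioc_mem_nhdsGT hα] with β hβ
    rw [sub_div_coe_le_iff ha hβ.1]
    have := hf.le_lineMap (dir i j) ha.le hv1.le (t := β / α) (div_nonneg hβ.1.le hα.le)
      ((div_le_one hα).2 hβ.2)
    rw [div_mul_cancel₀ _ hα.ne'] at this
    refine this.trans (le_of_eq ?_)
    congr 2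
    field_simp
  have h : s ≤ (v - a) / α := by exact_mod_cast hs.trans hle
  rw [le_div_iff₀ hα] at h
  linarith

theorem IsPolyhedralConvex.lt_of_lt_dirDeriv (hf : IsPolyhedralConvex f) (ha : f y = a)
    (hs : (s : EReal) < dirDeriv f y i j) {α : ℝ} (hα : 0 < α) :
    ((a + s * α : ℝ) : EReal) < f (y + α • dir i j) := by
  obtain ⟨v, hv1, hv2⟩ := EReal.lt_iff_exists_real_btwn.1 hs
  refine lt_of_lt_of_le ?_ (hf.le_of_le_dirDeriv ha hv2.le hα.le)
  have hv1 : s < v := by exact_mod_cast hv1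
  have : a + s * α < a + v * α := by gcongr
  exact_mod_cast this

theorem IsPolyhedralConvex.le_dirDeriv (hf : IsPolyhedralConvex f) (ha : f y = a)
    (h : ∀ α : ℝ, 0 < α → ((a + s * α : ℝ) : EReal) ≤ f (y + α • dir i j)) :
    (s : EReal) ≤ dirDeriv f y i j := by
  refine ge_of_tendsto (tendsto_dirDeriv hf (mem_dom_of_eq_coe ha) i j) ?_
  filter_upwards [self_mem_nhdsWithin] with α hα
  exact (le_sub_div_coe_iff ha hα _).2 (h α hα)

theorem IsPolyhedralConvex.dirDeriv_self (hf : IsPolyhedralConvex f) (hy : y ∈ dom f) :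
    dirDeriv f y i i = 0 := by
  obtain ⟨a, ha⟩ := hf.exists_eq_coe hy
  refine tendsto_nhds_unique (tendsto_dirDeriv hf hy i i) (tendsto_const_nhds.congr fun α => ?_)
  rw [dir_self, smul_zero, add_zero, ha, ← EReal.coe_sub, sub_self, EReal.coe_zero,
    EReal.zero_div]

/-- A half-space of the epigraph that is tight and not vertical at `(y, f y)` supports the
function there, so no directional derivative is `-∞`. -/
theorem IsPolyhedralConvex.dirDeriv_ne_bot (hf : IsPolyhedralConvex f) (hy : y ∈ dom f) :
    dirDeriv f y i j ≠ ⊥ := by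
  obtain ⟨a, ha⟩ := hf.exists_eq_coe hy
  have hf' := hf
  obtain ⟨hbot, m, p, q, c, hepi⟩ := hf'
  have h1 := (hepi y a).1 ha.le
  obtain ⟨k, hk0, hk⟩ : ∃ k, q k < 0 ∧ (∑ l, p k l * y l) + q k * a = c k := by
    by_contra! hcon
    -- If every non-vertical half-space were slack, the point could be lowered in the epigraph.
    have hev : ∀ᶠ v in 𝓝[<] a, ∀ k, (∑ l, p k l * y l) + q k * v ≤ c k := by
      rw [eventually_all]
      intro k
      rcases lt_or_ge (q k) 0 with hq | hq
      · have hlt := lt_of_le_of_ne (h1 k) (hcon k hq)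
        have ht : Tendsto (fun v => (∑ l, p k l * y l) + q k * v) (𝓝[<] a)
            (𝓝 ((∑ l, p k l * y l) + q k * a)) :=
          (Continuous.tendsto (by fun_prop) a).mono_left nhdsWithin_le_nhds
        exact (ht.eventually_lt_const hlt).mono fun _ h => h.le
      · filter_upwards [self_mem_nhdsWithin] with v hv
        have : q k * v ≤ q k * a := mul_le_mul_of_nonneg_left (le_of_lt hv) hq
        linarith [h1 k]
    obtain ⟨v, hv, hva⟩ := (hev.and self_mem_nhdsWithin).exists
    have h2 : a ≤ v := by
      have := (hepi y v).2 hv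
      rw [ha] at this
      exact_mod_cast this
    exact absurd h2 (not_le.2 hva)
  have hle : (((∑ l, p k l * dir i j l) / (-q k) : ℝ) : EReal) ≤ dirDeriv f y i j := by
    refine hf.le_dirDeriv ha fun α hα => ?_
    by_contra! hlt
    obtain ⟨v, hv1, hv2⟩ := EReal.lt_iff_exists_real_btwn.1 hlt
    have hv2 : v < a + (∑ l, p k l * dir i j l) / (-q k) * α := by exact_mod_cast hv2
    have h2 := (hepi _ _).1 hv1.le k
    simp only [Pi.add_apply, Pi.smul_apply, smul_eq_mul, mul_add, Finset.sum_add_distrib,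
      mul_left_comm _ α, ← Finset.mul_sum] at h2
    have h3 := mul_lt_mul_of_neg_left hv2 hk0
    have e : q k * (a + (∑ l, p k l * dir i j l) / (-q k) * α)
        = q k * a - α * (∑ l, p k l * dir i j l) := by
      field_simp [hk0.ne]
      ring
    linarith
  exact ne_of_gt ((EReal.bot_lt_coe _).trans_le hle)

/-- A polyhedral convex function is affine on an initial segment of every ray along which its
directional derivative is finite. -/
theorem IsPolyhedralConvex.eventually_eq (hf : IsPolyhedralConvex f) (ha : f y = a)
    (hs : dirDeriv f y i j = s) :
    ∀ᶠ α in 𝓝[>] (0 : ℝ), f (y + α • dir i j) = ((a + s * α : ℝ) : EReal) := by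
  have hf' := hf
  obtain ⟨hbot, m, p, q, c, hepi⟩ := hf'
  have h1 := (hepi y a).1 ha.le
  suffices h : ∀ᶠ α in 𝓝[>] (0 : ℝ), ∀ k,
      (∑ l, p k l * (y + α • dir i j) l) + q k * (a + s * α) ≤ c k by
    filter_upwards [h, self_mem_nhdsWithin] with α hα hα0
    exact le_antisymm ((hepi _ _).2 hα) (hf.le_of_le_dirDeriv ha hs.ge (le_of_lt hα0))
  rw [eventually_all]
  intro k
  simp only [Pi.add_apply, Pi.smul_apply, smul_eq_mul, mul_add, Finset.sum_add_distrib,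
    mul_left_comm _ (_ : ℝ) (dir i j _), ← Finset.mul_sum]
  set D := ∑ l, p k l * dir i j l with hD
  rcases (h1 k).lt_or_eq with hlt | heq
  · have ht : Tendsto (fun α : ℝ => (∑ l, p k l * y l) + α * D + (q k * a + q k * (s * α)))
        (𝓝[>] 0) (𝓝 ((∑ l, p k l * y l) + 0 * D + (q k * a + q k * (s * 0)))) :=
      (Continuous.tendsto (by fun_prop) 0).mono_left nhdsWithin_le_nhds
    refine (ht.eventually_lt_const (by simpa using hlt)).mono fun _ h => h.le
  · -- A half-space tight at `(y, f y)` contains the difference quotients, hence their limit.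
    have ht := tendsto_dirDeriv hf (mem_dom_of_eq_coe ha) i j
    rw [hs] at ht
    have hreal := (EReal.tendsto_toReal (EReal.coe_ne_top s) (EReal.coe_ne_bot s)).comp ht
    have hq : D + q k * s ≤ 0 := by
      have hlim := (hreal.const_mul (q k)).const_add D
      rw [EReal.toReal_coe] at hlim
      refine le_of_tendsto hlim ?_
      filter_upwards [ht.eventually_lt_const (EReal.coe_lt_top s), self_mem_nhdsWithin,
        ht.eventually_const_lt (EReal.bot_lt_coe s)] with α hα hα0 hα1
      have hα0 : 0 < α := hα0
      have h2 := (sub_div_coe_le_iff ha hα0 (y + α • dir i j)).1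
        (EReal.coe_toReal (ne_of_lt hα) (ne_of_gt hα1)).ge
      have h3 := (hepi _ _).1 h2 k
      simp only [Pi.add_apply, Pi.smul_apply, smul_eq_mul, mul_add, Finset.sum_add_distrib,
        mul_left_comm _ α, ← Finset.mul_sum, ← hD] at h3
      simp only [Function.comp]
      set r := ((f (y + α • dir i j) - f y) / (α : EReal)).toReal
      by_contra! hpos
      have := mul_pos hpos hα0
      linarith
    filter_upwards [self_mem_nhdsWithin] with α hα0
    have := mul_nonpos_of_nonpos_of_nonneg hq (le_of_lt hα0)
    linarith

/-! ### Global growth bounds from the exchange axiom -/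

/-- A bound on all directional derivatives at `y` propagates to a global bound with half the
slope against the `ℓ¹`-distance: by exchange with `y`, any violating point can be moved closer to
`y` while it still violates the bound, and a closest violating point exists by compactness. -/
theorem IsPolyhedralMConvex.add_l1_le (hf : IsPolyhedralMConvex f) (ha : f y = a)
    (hs : ∀ i j, (s : EReal) ≤ dirDeriv f y i j) (z : Fin n → ℝ) :
    ((a + s / 2 * l1 (z - y) : ℝ) : EReal) ≤ f z := by
  obtain ⟨hp, hex⟩ := hf
  by_contra! hlt
  obtain ⟨b, hb⟩ := hp.exists_eq_coe (hlt.trans (EReal.coe_lt_top _))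
  rw [hb] at hlt
  have hlt : b < a + s / 2 * l1 (z - y) := by exact_mod_cast hlt
  let S : Set (Fin n → ℝ) :=
    {w | f w ≤ ((b - s / 2 * l1 (z - y) + s / 2 * l1 (w - y) : ℝ) : EReal)} ∩
      {w | l1 (w - y) ≤ l1 (z - y)}
  have hl1 : Continuous fun w : Fin n → ℝ => l1 (w - y) := continuous_l1.comp (by fun_prop)
  have hcomp : IsCompact S := by
    refine (isCompact_closedBall y (l1 (z - y))).of_isClosed_subset
      ((hp.isClosed_setOf_le continuous_id (by fun_prop)).inter
        (isClosed_le hl1 continuous_const)) fun w hw => ?_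
    rw [Metric.mem_closedBall, dist_pi_le_iff (by
      exact (Finset.sum_nonneg fun _ _ => abs_nonneg _))]
    exact fun l => (abs_le_l1 (w - y) l).trans hw.2
  have hzS : z ∈ S := by
    refine ⟨?_, le_refl (l1 (z - y))⟩
    simp only [Set.mem_ofPred_eq, hb, sub_add_cancel, le_refl]
  obtain ⟨w, hwS, hmin⟩ := hcomp.exists_isMinOn ⟨z, hzS⟩ hl1.continuousOn
  have hwd : w ∈ dom f := lt_of_le_of_lt hwS.1 (EReal.coe_lt_top _)
  have hyd : y ∈ dom f := mem_dom_of_eq_coe ha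
  obtain ⟨v, hv⟩ := hp.exists_eq_coe hwd
  have hwS1 := hwS.1
  simp only [Set.mem_ofPred_eq, hv, EReal.coe_le_coe_iff] at hwS1
  by_cases hwy : w = y
  · subst hwy
    rw [ha] at hv
    have hav : a = v := by exact_mod_cast hv
    simp [l1] at hwS1 hlt
    linarith
  obtain ⟨h, k, hh, hk, ε₀, hε₀, hε⟩ : ∃ h k, y h < w h ∧ w k < y k ∧ ∃ ε₀ : ℝ, 0 < ε₀ ∧
      ∀ ε ∈ Set.Icc 0 ε₀, f (w - ε • dir h k) + f (y + ε • dir h k) ≤ f w + f y := by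
    obtain ⟨l, hl⟩ := Function.ne_iff.1 hwy
    rcases lt_or_gt_of_ne hl with hl | hl
    · obtain ⟨m, hm, ε₀, h0, hε⟩ := hex y hyd w hwd l hl
      refine ⟨m, l, hm, hl, ε₀, h0, fun ε he => ?_⟩
      have := hε ε he
      rw [← neg_dir m l, smul_neg, sub_neg_eq_add, ← sub_eq_add_neg] at this
      rwa [add_comm (f (w - _)), add_comm (f w)]
    · obtain ⟨m, hm, ε₀, h0, hε⟩ := hex w hwd y hyd l hl
      exact ⟨l, m, hl, hm, ε₀, h0, hε⟩
  set ε := min ε₀ (min (w h - y h) (y k - w k))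
  have hεpos : 0 < ε := lt_min hε₀ (lt_min (sub_pos.2 hh) (sub_pos.2 hk))
  have hε1 : ε ≤ w h - y h := (min_le_right _ _).trans (min_le_left _ _)
  have hε2 : ε ≤ y k - w k := (min_le_right _ _).trans (min_le_right _ _)
  have hsum := hε ε ⟨hεpos.le, min_le_left _ _⟩
  have hlow := hp.le_of_le_dirDeriv ha (hs h k) hεpos.le
  have hnorm : l1 (w - ε • dir h k - y) = l1 (w - y) - 2 * ε := by
    rw [sub_right_comm]
    exact l1_sub_smul_dir hεpos (by simpa using hε1) (by simp only [Pi.sub_apply]; linarith)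
  have hup : f (w - ε • dir h k) ≤ ((v - s * ε : ℝ) : EReal) := by
    have h1 : f (w - ε • dir h k) + ((a + s * ε : ℝ) : EReal) ≤ ((v + a : ℝ) : EReal) := by
      refine (add_le_add le_rfl hlow).trans (hsum.trans ?_)
      rw [hv, ha, EReal.coe_add]
    rw [← EReal.le_sub_iff_add_le (.inl (EReal.coe_ne_bot _))
      (.inl (EReal.coe_ne_top _)), ← EReal.coe_sub] at h1
    convert h1 using 2
    ring
  have hmem : w - ε • dir h k ∈ S := by
    refine ⟨hup.trans ?_, ?_⟩
    · rw [hnorm, EReal.coe_le_coe_iff]; linarith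
    · have := hwS.2
      simp only [Set.mem_ofPred_eq] at this ⊢
      linarith
  have := hmin hmem
  simp only [Set.mem_ofPred_eq] at this
  linarith

/-- Where the global bound of `add_l1_le` is attained at `z`, every coordinate that increases from
`y` to `z` is the first index of a direction at `y` in which the bound on the slope is attained. -/
theorem IsPolyhedralMConvex.exists_dirDeriv_le_of_lt (hf : IsPolyhedralMConvex f) (ha : f y = a)
    (hs : ∀ i j, (s : EReal) ≤ dirDeriv f y i j)
    (hz : f z ≤ ((a + s / 2 * l1 (z - y) : ℝ) : EReal)) {h : Fin n} (hh : y h < z h) :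
    ∃ k, z k < y k ∧ dirDeriv f y h k ≤ s := by
  obtain ⟨k, hk, ε₀, hε₀, hε⟩ := hf.2 z (lt_of_le_of_lt hz (EReal.coe_lt_top _)) y
    (mem_dom_of_eq_coe ha) h hh
  refine ⟨k, hk, ?_⟩
  by_contra! hlt
  set ε := min ε₀ (min (z h - y h) (y k - z k))
  have hεpos : 0 < ε := lt_min hε₀ (lt_min (sub_pos.2 hh) (sub_pos.2 hk))
  have hε1 : ε ≤ z h - y h := (min_le_right _ _).trans (min_le_left _ _)
  have hε2 : ε ≤ y k - z k := (min_le_right _ _).trans (min_le_right _ _)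
  have hsum := hε ε ⟨hεpos.le, min_le_left _ _⟩
  have h1 := hf.1.lt_of_lt_dirDeriv ha hlt hεpos
  obtain ⟨v, hv1, hv2⟩ := EReal.lt_iff_exists_real_btwn.1 h1
  have h2 := hf.add_l1_le ha hs (z - ε • dir h k)
  rw [sub_right_comm, l1_sub_smul_dir hεpos (by simpa using hε1)
    (by simp only [Pi.sub_apply]; linarith)] at h2
  have h3 := (add_le_add h2 hv2.le).trans (hsum.trans (add_le_add hz ha.le))
  rw [← EReal.coe_add, ← EReal.coe_add, EReal.coe_le_coe_iff] at h3
  have hv1 : a + s * ε < v := by exact_mod_cast hv1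
  linarith

/-- The counterpart of `exists_dirDeriv_le_of_lt` for a coordinate that decreases from `y` to
`z`. -/
theorem IsPolyhedralMConvex.exists_dirDeriv_le_of_gt (hf : IsPolyhedralMConvex f) (ha : f y = a)
    (hs : ∀ i j, (s : EReal) ≤ dirDeriv f y i j)
    (hz : f z ≤ ((a + s / 2 * l1 (z - y) : ℝ) : EReal)) {k : Fin n} (hk : z k < y k) :
    ∃ h, y h < z h ∧ dirDeriv f y h k ≤ s := by
  obtain ⟨h, hh, ε₀, hε₀, hε⟩ := hf.2 y (mem_dom_of_eq_coe ha) z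
    (lt_of_le_of_lt hz (EReal.coe_lt_top _)) k hk
  refine ⟨h, hh, ?_⟩
  by_contra! hlt
  set ε := min ε₀ (min (z h - y h) (y k - z k))
  have hεpos : 0 < ε := lt_min hε₀ (lt_min (sub_pos.2 hh) (sub_pos.2 hk))
  have hε1 : ε ≤ z h - y h := (min_le_right _ _).trans (min_le_left _ _)
  have hε2 : ε ≤ y k - z k := (min_le_right _ _).trans (min_le_right _ _)
  have hsum := hε ε ⟨hεpos.le, min_le_left _ _⟩
  rw [← neg_dir h k, smul_neg, sub_neg_eq_add, ← sub_eq_add_neg] at hsum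
  have h1 := hf.1.lt_of_lt_dirDeriv ha hlt hεpos
  obtain ⟨v, hv1, hv2⟩ := EReal.lt_iff_exists_real_btwn.1 h1
  have h2 := hf.add_l1_le ha hs (z - ε • dir h k)
  rw [sub_right_comm, l1_sub_smul_dir hεpos (by simpa using hε1)
    (by simp only [Pi.sub_apply]; linarith)] at h2
  have h3 := (add_le_add hv2.le h2).trans (hsum.trans (add_le_add ha.le hz))
  rw [← EReal.coe_add, ← EReal.coe_add, EReal.coe_le_coe_iff] at h3
  have hv1 : a + s * ε < v := by exact_mod_cast hv1
  linarith

/-! ### The effect of a long step -/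

variable {c : ℝ}

/-- Both pieces of the path `y`, `y + c (χ_i - χ_j)`, `y + c (χ_i - χ_j) + α (χ_h - χ_k)` have
`ℓ¹`-length at most twice their step, so the global bound seen from `y` controls the slope at the
end of the step. -/
theorem le_dirDeriv_long_step (hf : IsPolyhedralMConvex f) (hs0 : s < 0) (ha : f y = a)
    (hs : ∀ i j, (s : EReal) ≤ dirDeriv f y i j) (hc0 : 0 ≤ c)
    (hc : f (y + c • dir i j) = ((a + s * c : ℝ) : EReal)) (h k : Fin n) :
    (s : EReal) ≤ dirDeriv f (y + c • dir i j) h k := by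
  refine hf.1.le_dirDeriv hc fun α hα => le_trans ?_ (hf.add_l1_le ha hs _)
  rw [EReal.coe_le_coe_iff, add_assoc y, add_sub_cancel_left]
  have h1 := (l1_add_le (c • dir i j) (α • dir h k)).trans
    (add_le_add (l1_smul_dir_le hc0 i j) (l1_smul_dir_le hα.le h k))
  nlinarith

/-- If a direction at the end of a long step still has slope `s`, then a short move in that
direction attains the global bound seen from the start `y` of the step. -/
theorem eventually_le_l1_long_step (hf : IsPolyhedralMConvex f) (hs0 : s < 0) (hc0 : 0 ≤ c)
    (hc : f (y + c • dir i j) = ((a + s * c : ℝ) : EReal)) {h k : Fin n}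
    (hd : dirDeriv f (y + c • dir i j) h k = s) :
    ∀ᶠ α in 𝓝[>] (0 : ℝ), f (y + c • dir i j + α • dir h k) = ((a + s * (c + α) : ℝ) : EReal) ∧
      f (y + c • dir i j + α • dir h k) ≤
        ((a + s / 2 * l1 (y + c • dir i j + α • dir h k - y) : ℝ) : EReal) := by
  filter_upwards [hf.1.eventually_eq hc hd, self_mem_nhdsWithin] with α hα hα0
  have e : a + s * c + s * α = a + s * (c + α) := by ring
  rw [e] at hα
  refine ⟨hα, ?_⟩
  rw [hα, EReal.coe_le_coe_iff, add_assoc y, add_sub_cancel_left]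
  have h1 := (l1_add_le (c • dir i j) (α • dir h k)).trans
    (add_le_add (l1_smul_dir_le hc0 i j) (l1_smul_dir_le (le_of_lt hα0) h k))
  nlinarith

theorem lt_dirDeriv_long_step_of_fst_eq (hf : IsPolyhedralMConvex f) (hs0 : s < 0) (ha : f y = a)
    (hs : ∀ i j, (s : EReal) ≤ dirDeriv f y i j) (hc0 : 0 ≤ c)
    (hc : f (y + c • dir i j) = ((a + s * c : ℝ) : EReal)) {k : Fin n} (hkj : k ≠ j)
    (hk : (s : EReal) < dirDeriv f y i k) :
    (s : EReal) < dirDeriv f (y + c • dir i j) i k := by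
  by_cases hki : k = i
  · rw [hki, hf.1.dirDeriv_self (mem_dom_of_eq_coe hc)]
    exact_mod_cast hs0
  refine lt_of_le_of_ne (le_dirDeriv_long_step hf hs0 ha hs hc0 hc i k) fun heq => ?_
  obtain ⟨α, ⟨-, hα⟩, hα0⟩ :=
    ((eventually_le_l1_long_step hf hs0 hc0 hc heq.symm).and self_mem_nhdsWithin).exists
  have hα0 : 0 < α := hα0
  obtain ⟨h, hh, hle⟩ := hf.exists_dirDeriv_le_of_gt ha hs hα (k := k) (by
    simp [dir_apply, hki, hkj, hα0])
  -- Only the coordinate `i` has increased.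
  have hhi : h = i := by
    by_contra hne
    simp only [Pi.add_apply, Pi.smul_apply, smul_eq_mul, dir_apply, hne, if_false] at hh
    split_ifs at hh <;> linarith
  rw [hhi] at hle
  exact absurd hk (not_lt.2 hle)

/-- A first index all of whose directions have slope greater than `s` keeps this property in a
long step along a direction of slope `s`. -/
theorem lt_dirDeriv_long_step_of_forall (hf : IsPolyhedralMConvex f) (hs0 : s < 0) (ha : f y = a)
    (hs : ∀ i j, (s : EReal) ≤ dirDeriv f y i j) (hij : dirDeriv f y i j = s) (hc0 : 0 ≤ c)
    (hc : f (y + c • dir i j) = ((a + s * c : ℝ) : EReal)) {h : Fin n}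
    (hh : ∀ k, (s : EReal) < dirDeriv f y h k) (k : Fin n) :
    (s : EReal) < dirDeriv f (y + c • dir i j) h k := by
  have hhi : h ≠ i := by
    rintro rfl
    exact (hh j).ne' hij
  rcases hc0.eq_or_lt with rfl | hcpos
  · simpa using hh k
  by_cases hkh : k = h
  · rw [hkh, hf.1.dirDeriv_self (mem_dom_of_eq_coe hc)]
    exact_mod_cast hs0
  refine lt_of_le_of_ne (le_dirDeriv_long_step hf hs0 ha hs hc0 hc h k) fun heq => ?_
  obtain ⟨α, ⟨hαe, hα⟩, hα0, hαc⟩ := ((eventually_le_l1_long_step hf hs0 hc0 hc heq.symm).and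
    (Ioc_mem_nhdsGT hcpos)).exists
  by_cases hhj : h = j
  · -- The combined displacement is `(c - α) (χ_i - χ_j) + α (χ_i - χ_k)`, too short for the
    -- decrease of the function.
    subst hhj
    have e : y + c • dir i h + α • dir h k - y = (c - α) • dir i h + α • dir i k := by
      simp only [dir, smul_sub, sub_smul]
      abel
    have h1 := (l1_add_le ((c - α) • dir i h) (α • dir i k)).trans
      (add_le_add (l1_smul_dir_le (sub_nonneg.2 hαc) i h) (l1_smul_dir_le hα0.le i k))
    have h2 := hf.add_l1_le ha hs (y + c • dir i h + α • dir h k)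
    rw [hαe, e, EReal.coe_le_coe_iff] at h2
    nlinarith
  · obtain ⟨k', -, hle⟩ := hf.exists_dirDeriv_le_of_lt ha hs hα (h := h) (by
      simp [dir_apply, hhi, hhj, Ne.symm hkh, hα0])
    exact absurd (hh k') (not_lt.2 hle)

theorem IsStepLength.eq_coe (hd : dirDeriv f y i j = s) (ha : f y = a)
    (hc : IsStepLength f y i j c) : f (y + c • dir i j) = ((a + s * c : ℝ) : EReal) := by
  have h := hc.1.2
  rw [hd, ha, ← EReal.coe_mul] at h
  generalize f (y + c • dir i j) = w at h ⊢
  induction w with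
  | bot => exact absurd h (by rw [EReal.bot_sub]; exact (EReal.coe_ne_bot _).symm)
  | top => exact absurd h (by rw [EReal.top_sub_coe]; exact (EReal.coe_ne_top _).symm)
  | coe w =>
    rw [← EReal.coe_sub, EReal.coe_eq_coe_iff] at h
    rw [EReal.coe_eq_coe_iff]
    linarith

theorem sub_eq_mul_dirDeriv (hd : dirDeriv f y i j = s) (ha : f y = a) {t : ℝ}
    (h : f (y + t • dir i j) = ((a + s * t : ℝ) : EReal)) :
    f (y + t • dir i j) - f y = (t : EReal) * dirDeriv f y i j := by
  rw [h, ha, hd, ← EReal.coe_sub, ← EReal.coe_mul, add_sub_cancel_left, mul_comm]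

/-- By maximality of the step length, the slope in the direction of a long step increases. -/
theorem IsStepLength.lt_dirDeriv (hf : IsPolyhedralMConvex f) (hs0 : s < 0) (ha : f y = a)
    (hs : ∀ i j, (s : EReal) ≤ dirDeriv f y i j) (hd : dirDeriv f y i j = s)
    (hc : IsStepLength f y i j c) : (s : EReal) < dirDeriv f (y + c • dir i j) i j := by
  have hce := hc.eq_coe hd ha
  refine lt_of_le_of_ne (le_dirDeriv_long_step hf hs0 ha hs hc.1.1 hce i j) fun heq => ?_
  obtain ⟨α, ⟨hα, -⟩, hα0⟩ :=
    ((eventually_le_l1_long_step hf hs0 hc.1.1 hce heq.symm).and self_mem_nhdsWithin).exists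
  have hα0 : 0 < α := hα0
  rw [add_assoc, ← add_smul] at hα
  have := hc.2 ⟨add_nonneg hc.1.1 hα0.le, sub_eq_mul_dirDeriv hd ha hα⟩
  linarith

theorem exists_isStepLength (hf : IsPolyhedralConvex f) (hb : Bornology.IsBounded (dom f))
    (ha : f y = a) (hd : dirDeriv f y i j = s) (hij : i ≠ j) : ∃ c, IsStepLength f y i j c := by
  set T : Set ℝ := {t | 0 ≤ t} ∩ {t | f (y + t • dir i j) ≤ ((a + s * t : ℝ) : EReal)} with hT
  have hclosed : IsClosed T :=
    (isClosed_le continuous_const continuous_id).inter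
      (hf.isClosed_setOf_le (by fun_prop) (by fun_prop))
  have hne : T.Nonempty := ⟨0, by simp [hT, ha]⟩
  have hbdd : BddAbove T := by
    obtain ⟨R, hR⟩ := hb.subset_closedBall y
    refine ⟨R, fun t ht => ?_⟩
    have h1 := hR (show y + t • dir i j ∈ dom f from lt_of_le_of_lt ht.2 (EReal.coe_lt_top _))
    have h2 := (dist_le_pi_dist (y + t • dir i j) y i).trans h1
    simp [dir_apply, hij] at h2
    exact (le_abs_self t).trans h2
  have hgt := hclosed.isGreatest_csSup hne hbdd
  refine ⟨sSup T, ?_⟩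
  suffices h : {t : ℝ | 0 ≤ t ∧ f (y + t • dir i j) - f y = (t : EReal) * dirDeriv f y i j} = T by
    rw [IsStepLength, h]
    exact hgt
  refine Set.ext fun t => and_congr_right fun ht0 => ⟨fun ht => ?_, fun ht => ?_⟩
  · rw [hd, ha, ← EReal.coe_mul] at ht
    have := (EReal.sub_le_iff_le_add (by simp) (by simp)).1 ht.le
    rw [← EReal.coe_add] at this
    refine this.trans (le_of_eq ?_)
    congr 1
    ring
  · exact sub_eq_mul_dirDeriv hd ha (le_antisymm ht (hf.le_of_le_dirDeriv ha hd.ge ht0))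

/-! ### Invariant and termination of the procedure -/

/-- The invariant of the procedure with threshold `s`: the current point lies in the domain, its
slope is at least `s`, and only directions with first index in `P` may have slope equal to `s`. In
the inner loop, the directions with first index `i` among these have their second index in `M`. -/
def Invariant (f : (Fin n → ℝ) → EReal) (s : ℝ) : State n → Prop
  | .outer y P => y ∈ dom f ∧ (∀ i j, (s : EReal) ≤ dirDeriv f y i j) ∧
      ∀ h ∉ P, ∀ k, (s : EReal) < dirDeriv f y h k
  | .inner y P i M => y ∈ dom f ∧ (∀ i j, (s : EReal) ≤ dirDeriv f y i j) ∧
      (∀ h ∉ P, ∀ k, (s : EReal) < dirDeriv f y h k) ∧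
      ∀ k ∉ M, (s : EReal) < dirDeriv f y i k

theorem Step.invariant (hf : IsPolyhedralMConvex f) (hs0 : s < 0) (hx : slope f x = s)
    {σ τ : State n} (h : Step f x σ τ) (hσ : Invariant f s σ) : Invariant f s τ := by
  cases h with
  | choose y P i hi =>
    obtain ⟨hy, hs, hP⟩ := hσ
    refine ⟨hy, hs, hP, fun k hk => ?_⟩
    obtain rfl : k = i := by simpa using hk
    rw [hf.1.dirDeriv_self hy]
    exact_mod_cast hs0
  | move y P i M j hj h c hc =>
    obtain ⟨hy, hs, hP, hM⟩ := hσ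
    rw [hx] at h
    obtain ⟨a, ha⟩ := hf.1.exists_eq_coe hy
    have hce := hc.eq_coe h ha
    refine ⟨mem_dom_of_eq_coe hce, le_dirDeriv_long_step hf hs0 ha hs hc.1.1 hce,
      fun h' hh' => lt_dirDeriv_long_step_of_forall hf hs0 ha hs h hc.1.1 hce (hP h' hh'),
      fun k hk => ?_⟩
    by_cases hkj : k = j
    · rw [hkj]
      exact hc.lt_dirDeriv hf hs0 ha hs h
    · exact lt_dirDeriv_long_step_of_fst_eq hf hs0 ha hs hc.1.1 hce hkj
        (hM k fun hkM => hk (Finset.mem_erase.2 ⟨hkj, hkM⟩))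
  | skip y P i M j hj h =>
    obtain ⟨hy, hs, hP, hM⟩ := hσ
    rw [hx] at h
    refine ⟨hy, hs, hP, fun k hk => ?_⟩
    by_cases hkj : k = j
    · rw [hkj]
      exact lt_of_le_of_ne (hs i j) h.symm
    · exact hM k fun hkM => hk (Finset.mem_erase.2 ⟨hkj, hkM⟩)
  | next y P i =>
    obtain ⟨hy, hs, hP, hM⟩ := hσ
    refine ⟨hy, hs, fun h hh k => ?_⟩
    by_cases hhi : h = i
    · rw [hhi]
      exact hM k (Finset.notMem_empty k)
    · exact hP h (fun hhP => hh (Finset.mem_erase.2 ⟨hhi, hhP⟩)) k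

theorem Reaches.invariant (hf : IsPolyhedralMConvex f) (hs0 : s < 0) (hx : slope f x = s)
    {σ τ : State n} (h : Reaches f x σ τ) (hσ : Invariant f s σ) : Invariant f s τ := by
  induction h with
  | refl => exact hσ
  | tail _ hstep ih => exact hstep.invariant hf hs0 hx ih

theorem exists_reaches_outer (hf : IsPolyhedralMConvex f) (hb : Bornology.IsBounded (dom f))
    (hs0 : s < 0) (hx : slope f x = s) (P : Finset (Fin n)) (i : Fin n) (M : Finset (Fin n)) :
    ∀ y, Invariant f s (.inner y P i M) →
      ∃ y', Reaches f x (.inner y P i M) (.outer y' (P.erase i)) := by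
  induction M using Finset.strongInduction with
  | H M ih =>
    intro y hy
    rcases M.eq_empty_or_nonempty with rfl | ⟨j, hj⟩
    · exact ⟨y, .single (.next y P i)⟩
    obtain ⟨y₁, hstep⟩ : ∃ y₁, Step f x (.inner y P i M) (.inner y₁ P i (M.erase j)) := by
      by_cases h : dirDeriv f y i j = slope f x
      · have hij : i ≠ j := by
          rintro rfl
          rw [hx, hf.1.dirDeriv_self hy.1] at h
          exact hs0.ne (by exact_mod_cast h.symm)
        obtain ⟨a, ha⟩ := hf.1.exists_eq_coe hy.1
        obtain ⟨c, hc⟩ := exists_isStepLength hf.1 hb ha (h.trans hx) hij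
        exact ⟨_, .move y P i M j hj h c hc⟩
      · exact ⟨_, .skip y P i M j hj h⟩
    obtain ⟨y', hy'⟩ := ih _ (Finset.erase_ssubset hj) y₁ (hstep.invariant hf hs0 hx hy)
    exact ⟨y', .head hstep hy'⟩

theorem exists_reaches_final (hf : IsPolyhedralMConvex f) (hb : Bornology.IsBounded (dom f))
    (hs0 : s < 0) (hx : slope f x = s) (P : Finset (Fin n)) :
    ∀ y, Invariant f s (.outer y P) → ∃ y', Reaches f x (.outer y P) (final y') := by
  induction P using Finset.strongInduction with
  | H P ih =>
    intro y hy
    rcases P.eq_empty_or_nonempty with rfl | ⟨i, hi⟩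
    · exact ⟨y, .refl⟩
    have hstep := Step.choose (f := f) (x := x) y P i hi
    have hinv := hstep.invariant hf hs0 hx hy
    obtain ⟨y₁, h₁⟩ := exists_reaches_outer hf hb hs0 hx P i _ y hinv
    obtain ⟨y', hy'⟩ := ih _ (Finset.erase_ssubset hi) y₁ (h₁.invariant hf hs0 hx hinv)
    exact ⟨y', .head hstep (h₁.trans hy')⟩

theorem slope_le_dirDeriv (f : (Fin n → ℝ) → EReal) (y : Fin n → ℝ) (i j : Fin n) :
    slope f y ≤ dirDeriv f y i j :=
  (iInf_le (fun i => ⨅ j, dirDeriv f y i j) i).trans (iInf_le (fun j => dirDeriv f y i j) j)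

theorem IsPolyhedralConvex.exists_slope_eq_coe (hf : IsPolyhedralConvex f) (hx : x ∈ dom f)
    (h : slope f x < 0) : ∃ s : ℝ, slope f x = s := by
  have hn : Nonempty (Fin n) := by
    by_contra hn
    rw [not_nonempty_iff] at hn
    rw [slope, iInf_of_empty] at h
    exact not_top_lt h
  obtain ⟨i, hi⟩ := exists_eq_ciInf_of_finite (f := fun i => ⨅ j, dirDeriv f x i j)
  obtain ⟨j, hj⟩ := exists_eq_ciInf_of_finite (f := fun j => dirDeriv f x i j)
  have e : slope f x = dirDeriv f x i j := hi.symm.trans hj.symm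
  exact ⟨(slope f x).toReal, (EReal.coe_toReal (ne_of_lt (h.trans EReal.zero_lt_top))
    (e ▸ hf.dirDeriv_ne_bot hx)).symm⟩

theorem coe_lt_slope (h : ∀ i j, (s : EReal) < dirDeriv f y i j) : (s : EReal) < slope f y := by
  rcases isEmpty_or_nonempty (Fin n) with hn | hn
  · rw [slope, iInf_of_empty]
    exact EReal.coe_lt_top s
  obtain ⟨i, hi⟩ := exists_eq_ciInf_of_finite (f := fun i => ⨅ j, dirDeriv f y i j)
  obtain ⟨j, hj⟩ := exists_eq_ciInf_of_finite (f := fun j => dirDeriv f y i j)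
  have e : slope f y = dirDeriv f y i j := hi.symm.trans hj.symm
  exact e ▸ h i j

end PolyM

theorem mainTheorem4 (n : ℕ) (f : (Fin n → ℝ) → EReal) (hf : PolyM.IsPolyhedralMConvex f)
    (x : Fin n → ℝ) (hx : x ∈ PolyM.dom f) (hslope : PolyM.slope f x < 0) :
    (∀ x' : Fin n → ℝ, PolyM.IsOutput f x x' → PolyM.slope f x < PolyM.slope f x') ∧
    (Bornology.IsBounded (PolyM.dom f) →
      ∀ s : PolyM.State n, PolyM.Reaches f x (PolyM.start x) s →
        ∃ x' : Fin n → ℝ, PolyM.Reaches f x s (PolyM.final x')) := by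
  obtain ⟨s, hs⟩ := hf.1.exists_slope_eq_coe hx hslope
  have hs0 : s < 0 := by
    rw [hs] at hslope
    exact_mod_cast hslope
  have hinit : PolyM.Invariant f s (.outer x Finset.univ) :=
    ⟨hx, fun i j => hs.symm.le.trans (PolyM.slope_le_dirDeriv f x i j),
      fun h hh => absurd (Finset.mem_univ h) hh⟩
  refine ⟨fun x' hx' => ?_, fun hb σ hσ => ?_⟩
  · have hinv : PolyM.Invariant f s (.outer x' ∅) :=
      PolyM.Reaches.invariant hf hs0 hs hx' hinit
    rw [hs]
    exact PolyM.coe_lt_slope fun i j => hinv.2.2 i (Finset.notMem_empty i) j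
  · have hinv := PolyM.Reaches.invariant hf hs0 hs hσ hinit
    cases σ with
    | outer y P => exact PolyM.exists_reaches_final hf hb hs0 hs P y hinv
    | inner y P i M =>
      obtain ⟨y₁, h₁⟩ := PolyM.exists_reaches_outer hf hb hs0 hs P i M y hinv
      obtain ⟨y', hy'⟩ := PolyM.exists_reaches_final hf hb hs0 hs _ y₁
        (h₁.invariant hf hs0 hs hinv)
      exact ⟨y', h₁.trans hy'⟩
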